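/- Let $r=2^s$ with $s\ge 1$, and let $\mathcal Y=(\Omega,\{R_0,\dots,R_r\})$ be a commutative association scheme with $r$ classes on $n=|\Omega|$ points. Suppose that $\mathcal Y$ is amorphic, i.e. it is symmetric and every fusion of $\mathcal Y$ (obtained by merging non-identity relations according to an arbitrary partition of them) is again an association scheme, and that $\mathcal Y$ is pseudocyclic in the sense that all the non-identity relations $R_1,\dots,R_r$ have the same valency. If $r=2$, suppose in addition that the nontrivial multiplicities of $\mathcal Y$ are equal, i.e. that all primitive idempotents of its Bose–Mesner algebra other than $\frac1n J$ have the same rank. Then $\frac{n-1}{r}$ is an integer and there exists a distance-regular antipodal cover of a complete graph (DRACKN) with parameters $\left(n+1,\,r,\,\frac{n-1}{r}\right)$. Here a DRACKN with parameters $(m,r,c)$ is a distance-regular antipodal graph of diameter $3$ with $m$ antipodal classes (fibres), each of size $r$, such that the edges between any two distinct fibres form a perfect matching and any two nonadjacent vertices in distinct fibres have exactly $c$ common neighbours. -/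

import Mathlib

/-- A commutative association scheme with `d` classes on the finite point set `Ω`.
The partition of `Ω × Ω` into relations `R_0, …, R_d` is given by the map `col` that sends
`(x, y)` to the index of the relation containing it. -/
structure AssociationScheme (Ω : Type*) [Fintype Ω] (d : ℕ) where
  /-- The index of the relation that contains `(x, y)`. -/
  col : Ω → Ω → Fin (d + 1)
  /-- The intersection numbers; `inter i j k` is `p_{ij}^k`. -/
  inter : Fin (d + 1) → Fin (d + 1) → Fin (d + 1) → ℕ
  /-- The parts of a partition are nonempty. -/
  nonempty : ∀ i, ∃ x y, col x y = i
  /-- `R_0` is the identity relation. -/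
  diag : ∀ x y, col x y = 0 ↔ x = y
  /-- The transpose of a relation of the scheme is a relation of the scheme. -/
  transpose : ∀ i, ∃ j, ∀ x y, col y x = i ↔ col x y = j
  regular : ∀ i j k x y, col x y = k →
    (Finset.univ.filter fun z => col x z = i ∧ col z y = j).card = inter i j k
  comm : ∀ i j k, inter i j k = inter j i k

namespace AssociationScheme

variable {Ω : Type*} [Fintype Ω] {d : ℕ}

/-- Every relation equals its transpose. -/
def IsSymmetric (X : AssociationScheme Ω d) : Prop :=
  ∀ x y, X.col x y = X.col y x

/-- Merging the relations of `X` along `π` (a partition of the indices into `e + 1` nonempty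
parts, the part with label `0` being `{0}`) gives an association scheme. -/
def FusionIsScheme (X : AssociationScheme Ω d) {e : ℕ} (π : Fin (d + 1) → Fin (e + 1)) : Prop :=
  ∃ Y : AssociationScheme Ω e, ∀ x y, Y.col x y = π (X.col x y)

/-- A symmetric scheme each of whose fusions is an association scheme. -/
def IsAmorphic (X : AssociationScheme Ω d) : Prop :=
  X.IsSymmetric ∧
    ∀ (e : ℕ) (π : Fin (d + 1) → Fin (e + 1)), Function.Surjective π → (∀ i, π i = 0 ↔ i = 0) →
      X.FusionIsScheme π

/-- All non-identity relations have the same valency. -/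
def IsPseudocyclic (X : AssociationScheme Ω d) : Prop :=
  ∃ k : ℕ, ∀ i, i ≠ 0 → ∀ x, (Finset.univ.filter fun y => X.col x y = i).card = k

/-- The adjacency matrix of the relation `R_i`. -/
def adjMatrix (X : AssociationScheme Ω d) (i : Fin (d + 1)) : Matrix Ω Ω ℂ :=
  Matrix.of fun x y => if X.col x y = i then 1 else 0

/-- The Bose-Mesner algebra, as the span of the adjacency matrices. -/
def boseMesner (X : AssociationScheme Ω d) : Submodule ℂ (Matrix Ω Ω ℂ) :=
  Submodule.span ℂ (Set.range X.adjMatrix)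

/-- The primitive (that is, minimal nonzero) idempotents of the Bose-Mesner algebra. -/
def IsPrimitiveIdempotent (X : AssociationScheme Ω d) (E : Matrix Ω Ω ℂ) : Prop :=
  E ∈ X.boseMesner ∧ E * E = E ∧ E ≠ 0 ∧
    ∀ F ∈ X.boseMesner, F * F = F → F * E = F → F = 0 ∨ F = E

/-- All nontrivial multiplicities of the scheme are equal: the primitive idempotents other than
the trivial one, `(1 / |Ω|) J`, all have the same rank. -/
def HasEqualMultiplicities (X : AssociationScheme Ω d) : Prop :=
  ∃ m : ℕ, ∀ E : Matrix Ω Ω ℂ, X.IsPrimitiveIdempotent E →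
    E ≠ Matrix.of (fun _ _ => (1 / (Fintype.card Ω : ℂ))) → E.rank = m

end AssociationScheme

/-- A connected graph in which, for all vertices `x`, `y`, the numbers of neighbours of `y` at
distance `dist x y + 1`, respectively `dist x y - 1`, from `x` depend only on `dist x y`. -/
def SimpleGraph.IsDistanceRegular {V : Type*} (G : SimpleGraph V) : Prop :=
  G.Connected ∧ ∃ b c : ℕ → ℕ, ∀ x y : V,
    {z | G.Adj y z ∧ G.dist x z = G.dist x y + 1}.ncard = b (G.dist x y) ∧
    {z | G.Adj y z ∧ G.dist x z + 1 = G.dist x y}.ncard = c (G.dist x y)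

/-- `G` is a distance-regular antipodal cover of the complete graph `K_n` (a DRACKN) with
parameters `(n, r, c)`: a distance-regular antipodal graph of diameter three with `n` antipodal
classes (the fibres), each of size `r`, such that the edges between any two distinct fibres form
a perfect matching, and two vertices at distance two (equivalently, two nonadjacent vertices in
distinct fibres) have exactly `c` common neighbours. -/
structure SimpleGraph.IsDRACKN {V : Type*} [Finite V] (G : SimpleGraph V) (n r c : ℕ) : Prop where
  distanceRegular : G.IsDistanceRegular
  diam_eq : G.diam = 3
  antipodal : Equivalence fun x y : V => x = y ∨ G.dist x y = 3
  card_fibre : ∀ x : V, {y | x = y ∨ G.dist x y = 3}.ncard = r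
  /-- There are `n` fibres. -/
  card_fibres : Nat.card (Quotient (⟨_, antipodal⟩ : Setoid V)) = n
  /-- The covering map onto `K_n`: `x` has exactly one neighbour in every other fibre. -/
  matching : ∀ x y : V, ¬ (x = y ∨ G.dist x y = 3) →
    ∃! z : V, (y = z ∨ G.dist y z = 3) ∧ G.Adj x z
  common : ∀ x y : V, G.dist x y = 2 → (G.commonNeighbors x y).ncard = c

/-! Add a point `none` to `Ω`, put an elementary abelian 2-group `H` of order `r` over every point,
label the non-identity relations bijectively by `H`, and use these labels as voltages, with voltage
zero at `none`. The resulting cover is a DRACKN as soon as, for all distinct `x`, `y` and every `h`,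
exactly `κ` two-step paths from `x` to `y` have total voltage `h`, where `κ` is the common valency
(`voltageCover.isDRACKN`). Since `n = r * κ + 1`, this `κ` is the required `c`.

If one end is `none`, the count is a valency. For `x`, `y` in `Ω` with `(x, y)` in `R_k` it is a sum
of `p_{ij}^k` over pairs whose labels add up to `h`. For `h = 0` these are the pairs `(i, i)`; for
`h ≠ 0` they are `(i, σ i)` with `σ` a fixed-point-free involution. Both sums are compared term by
term with a row sum `∑ j, p_{mj}^k = κ`.

The comparison needs two facts: `p_{ii}^j` is one constant `b` for `i ≠ j`, and `p_{ij}^k` depends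
only on `k` for distinct `i`, `j`, `k`. For `r ≥ 3` both come from merging two relations, together
with the symmetry `p_{ij}^k = p_{kj}^i` given by equal valencies. For `r = 2` merging says nothing;
equal multiplicities then force `p_{11}^2 = κ / 2`, and the second fact is vacuous. -/

/-! ### Covers of complete graphs from voltages -/

/-- The cover of the complete graph on `W` with voltages `f` in the group `H`. -/
def voltageCover {W H : Type*} [AddCommGroup H] (f : W → W → H)
    (hf : ∀ x y, f y x = -f x y) : SimpleGraph (W × H) where
  Adj u v := u.1 ≠ v.1 ∧ v.2 = u.2 + f u.1 v.1
  symm := ⟨fun u v h => ⟨h.1.symm, by rw [hf, h.2]; abel⟩⟩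
  loopless := ⟨fun _ h => h.1 rfl⟩

namespace voltageCover

variable {W H : Type*} [AddCommGroup H] {f : W → W → H}
  {hf : ∀ x y, f y x = -f x y} {c : ℕ}

theorem adj_iff {u v : W × H} :
    (voltageCover f hf).Adj u v ↔ u.1 ≠ v.1 ∧ v.2 = u.2 + f u.1 v.1 := Iff.rfl

theorem eq_of_adj_of_fst_eq {u v w : W × H} (hv : (voltageCover f hf).Adj u v)
    (hw : (voltageCover f hf).Adj u w) (h : v.1 = w.1) : v = w :=
  Prod.ext h (by rw [hv.2, hw.2, h])

theorem ncard_neighborSet [Finite W] (u : W × H) :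
    {v | (voltageCover f hf).Adj u v}.ncard = Nat.card W - 1 := by
  have : {v | (voltageCover f hf).Adj u v} = (fun z => (z, u.2 + f u.1 z)) '' {u.1}ᶜ := by
    ext ⟨z, a⟩
    simp only [adj_iff, Set.mem_ofPred_eq, Set.mem_image, Set.mem_compl_iff, Set.mem_singleton_iff,
      Prod.mk.injEq]
    constructor
    · rintro ⟨h, rfl⟩
      exact ⟨z, Ne.symm h, rfl, rfl⟩
    · rintro ⟨w, h, rfl, rfl⟩
      exact ⟨Ne.symm h, rfl⟩
  rw [this, Set.ncard_image_of_injective _ fun x y h => congrArg Prod.fst h, Set.ncard_compl,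
    Set.ncard_singleton]

/-- A common neighbour over `z` exists exactly when the path through `z` carries voltage `v.2 -
u.2`, and it is then unique. Adjacent `u`, `v` are included, so `a_1 = c_2 = c`. -/
theorem ncard_commonNeighbors
    (hc : ∀ x y, x ≠ y → ∀ h, {z | z ≠ x ∧ z ≠ y ∧ f x z + f z y = h}.ncard = c)
    {u v : W × H} (huv : u.1 ≠ v.1) :
    ((voltageCover f hf).commonNeighbors u v).ncard = c := by
  rw [← hc _ _ huv (v.2 - u.2), ← Set.ncard_image_of_injective (f := fun z => (z, u.2 + f u.1 z)) _
    fun x y h => congrArg Prod.fst h]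
  congr 1
  ext ⟨z, a⟩
  simp only [SimpleGraph.mem_commonNeighbors, adj_iff, Set.mem_ofPred_eq, Set.mem_image,
    Prod.mk.injEq]
  constructor
  · rintro ⟨⟨h1, rfl⟩, h2, h3⟩
    refine ⟨z, ⟨Ne.symm h1, Ne.symm h2, ?_⟩, rfl, rfl⟩
    rw [hf v.1 z, eq_sub_iff_add_eq]
    rw [← sub_eq_iff_eq_add] at h3
    rw [← h3]; abel
  · rintro ⟨w, ⟨h1, h2, h3⟩, rfl, rfl⟩
    refine ⟨⟨Ne.symm h1, rfl⟩, Ne.symm h2, ?_⟩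
    rw [hf w v.1, ← sub_eq_add_neg, eq_sub_iff_add_eq, add_assoc, h3]
    abel

/-- The neighbour of `v` in the fibre of `u`. -/
theorem setOf_adj_fst_eq {u v : W × H} (h : u.1 ≠ v.1) :
    {w | (voltageCover f hf).Adj v w ∧ u.1 = w.1} = {(u.1, v.2 + f v.1 u.1)} := by
  ext ⟨z, a⟩
  simp only [adj_iff, Set.mem_ofPred_eq, Set.mem_singleton_iff, Prod.mk.injEq]
  constructor
  · rintro ⟨⟨h1, rfl⟩, rfl⟩
    exact ⟨rfl, rfl⟩
  · rintro ⟨rfl, rfl⟩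
    exact ⟨⟨h.symm, rfl⟩, rfl⟩

variable (hc : ∀ x y, x ≠ y → ∀ h, {z | z ≠ x ∧ z ≠ y ∧ f x z + f z y = h}.ncard = c)
  (hc0 : 0 < c)

theorem commonNeighbors_eq_empty {u v : W × H} (huv : u ≠ v) (h : u.1 = v.1) :
    (voltageCover f hf).commonNeighbors u v = ∅ := by
  rw [Set.eq_empty_iff_forall_notMem]
  rintro w ⟨h1, h2⟩
  have h1 : (voltageCover f hf).Adj u w := h1
  have h2 : (voltageCover f hf).Adj v w := h2
  exact huv (eq_of_adj_of_fst_eq h1.symm h2.symm h)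

include hc hc0

theorem edist_eq_two {u v : W × H} (huv : u.1 ≠ v.1)
    (h : ¬(voltageCover f hf).Adj u v) : (voltageCover f hf).edist u v = 2 := by
  rw [SimpleGraph.edist_eq_two_iff]
  refine ⟨fun e => huv (by rw [e]), h, Set.nonempty_of_ncard_ne_zero ?_⟩
  rw [ncard_commonNeighbors hc huv]
  exact hc0.ne'

theorem edist_eq_three [Nontrivial W] {u v : W × H} (huv : u ≠ v) (h : u.1 = v.1) :
    (voltageCover f hf).edist u v = 3 := by
  apply le_antisymm
  · obtain ⟨y, hy⟩ := exists_ne u.1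
    have h1 : (voltageCover f hf).Adj u (y, u.2 + f u.1 y) := ⟨hy.symm, rfl⟩
    have h2 : ¬(voltageCover f hf).Adj (y, u.2 + f u.1 y) v := fun h2 =>
      huv (eq_of_adj_of_fst_eq h1.symm h2 h)
    refine (SimpleGraph.edist_triangle (v := (y, u.2 + f u.1 y))).trans ?_
    rw [edist_eq_two hc hc0 (by simpa [← h] using hy) h2, SimpleGraph.edist_eq_one_iff_adj.2 h1]
    norm_num
  · have : 2 < (voltageCover f hf).edist u v :=
      SimpleGraph.two_lt_edist_iff.2 ⟨huv, fun e => e.1 h, commonNeighbors_eq_empty huv h⟩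
    exact Order.add_one_le_of_lt this

theorem connected [Nontrivial W] : (voltageCover f hf).Connected := by
  rw [SimpleGraph.connected_iff]
  -- Distances are computed with `edist`, whose finiteness yields connectedness; `dist` would be
  -- zero on unreachable pairs.
  refine ⟨fun u v => SimpleGraph.reachable_of_edist_ne_top ?_, inferInstance⟩
  by_cases h0 : u = v
  · simp [h0]
  by_cases h1 : u.1 = v.1
  · rw [edist_eq_three hc hc0 h0 h1]; decide
  by_cases h2 : (voltageCover f hf).Adj u v
  · rw [SimpleGraph.edist_eq_one_iff_adj.2 h2]; decide
  · rw [edist_eq_two hc hc0 h1 h2]; decide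

theorem dist_eq_two_iff [Nontrivial W] {u v : W × H} :
    (voltageCover f hf).dist u v = 2 ↔ u.1 ≠ v.1 ∧ ¬(voltageCover f hf).Adj u v := by
  constructor
  · intro h
    refine ⟨fun e => ?_, fun e => ?_⟩
    · by_cases h0 : u = v
      · simp [h0] at h
      · simp [SimpleGraph.dist, edist_eq_three hc hc0 h0 e] at h
    · simp [SimpleGraph.dist_eq_one_iff_adj.2 e] at h
  · rintro ⟨h1, h2⟩
    simp [SimpleGraph.dist, edist_eq_two hc hc0 h1 h2]

theorem dist_eq_three_iff [Nontrivial W] {u v : W × H} :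
    (voltageCover f hf).dist u v = 3 ↔ u ≠ v ∧ u.1 = v.1 := by
  constructor
  · intro h
    refine ⟨fun e => by simp [e] at h, by_contra fun e => ?_⟩
    by_cases h2 : (voltageCover f hf).Adj u v
    · simp [SimpleGraph.dist_eq_one_iff_adj.2 h2] at h
    · simp [(dist_eq_two_iff hc hc0).2 ⟨e, h2⟩] at h
  · rintro ⟨h1, h2⟩
    simp [SimpleGraph.dist, edist_eq_three hc hc0 h1 h2]

theorem dist_cases [Nontrivial W] (u v : W × H) :
    u = v ∨ (voltageCover f hf).dist u v = 1 ∨ (voltageCover f hf).dist u v = 2 ∨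
      (voltageCover f hf).dist u v = 3 := by
  rw [SimpleGraph.dist_eq_one_iff_adj, dist_eq_two_iff hc hc0, dist_eq_three_iff hc hc0]
  tauto

theorem eq_or_dist_eq_three_iff [Nontrivial W] {u v : W × H} :
    (u = v ∨ (voltageCover f hf).dist u v = 3) ↔ u.1 = v.1 := by
  rw [dist_eq_three_iff hc hc0]
  exact ⟨by rintro (rfl | h); exacts [rfl, h.2], by tauto⟩

theorem isDistanceRegular [Finite W] [Finite H] [Nontrivial W] :
    (voltageCover f hf).IsDistanceRegular := by
  have conn : (voltageCover f hf).Connected := connected hc hc0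
  -- With `k = Nat.card W - 1` the intersection array is `{k, k - 1 - c, 1; 1, c, k}`.
  refine ⟨conn, fun t => if t = 0 then Nat.card W - 1 else if t = 1 then Nat.card W - 1 - (1 + c)
    else if t = 2 then 1 else 0, fun t => if t = 0 then 0 else if t = 1 then 1 else
    if t = 2 then c else Nat.card W - 1, fun u v => ?_⟩
  rcases dist_cases (hf := hf) hc hc0 u v with rfl | h | h | h
  · constructor
    · simp [SimpleGraph.dist_eq_one_iff_adj, ncard_neighborSet]
    · simp
  · have huv := SimpleGraph.dist_eq_one_iff_adj.1 h
    constructor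
    · have key : {z | (voltageCover f hf).Adj v z ∧
          (voltageCover f hf).dist u z = (voltageCover f hf).dist u v + 1} =
          {z | (voltageCover f hf).Adj v z} \
            ({u} ∪ (voltageCover f hf).commonNeighbors u v) := by
        ext z
        simp only [h, Nat.reduceAdd, dist_eq_two_iff hc hc0, Set.mem_ofPred_eq, Set.mem_sdiff,
          Set.mem_union, Set.mem_singleton_iff, SimpleGraph.mem_commonNeighbors, not_or]
        constructor
        · rintro ⟨h1, h2, h3⟩
          exact ⟨h1, fun e => h2 (by rw [e]), fun e => h3 e.1⟩
        · rintro ⟨h1, h2, h3⟩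
          exact ⟨h1, fun e => h2 (eq_of_adj_of_fst_eq h1 huv.symm e.symm), fun e => h3 ⟨e, h1⟩⟩
      rw [key, Set.ncard_sdiff, ncard_neighborSet, Set.ncard_union_eq, Set.ncard_singleton,
        ncard_commonNeighbors hc huv.1]
      · simp [h]
      · simp [SimpleGraph.mem_commonNeighbors]
      · rintro z (rfl | hz)
        · exact huv.symm
        · exact hz.2
    · have key : {z | (voltageCover f hf).Adj v z ∧
          (voltageCover f hf).dist u z + 1 = (voltageCover f hf).dist u v} = {u} := by
        ext z
        simp only [h, Nat.add_eq_right, conn.dist_eq_zero_iff, Set.mem_ofPred_eq,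
          Set.mem_singleton_iff]
        exact ⟨fun e => e.2.symm, by rintro rfl; exact ⟨huv.symm, rfl⟩⟩
      rw [key]
      simp [h]
  · have huv := (dist_eq_two_iff hc hc0).1 h
    constructor
    · have key : {z | (voltageCover f hf).Adj v z ∧
          (voltageCover f hf).dist u z = (voltageCover f hf).dist u v + 1} =
          {z | (voltageCover f hf).Adj v z ∧ u.1 = z.1} := by
        ext z
        simp only [h, Nat.reduceAdd, dist_eq_three_iff hc hc0, Set.mem_ofPred_eq]
        exact ⟨fun e => ⟨e.1, e.2.2⟩, fun e => ⟨e.1, fun e' => huv.2 (e' ▸ e.1.symm), e.2⟩⟩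
      rw [key, setOf_adj_fst_eq huv.1]
      simp [h]
    · have key : {z | (voltageCover f hf).Adj v z ∧
          (voltageCover f hf).dist u z + 1 = (voltageCover f hf).dist u v} =
          (voltageCover f hf).commonNeighbors u v := by
        ext z
        simp only [h, Nat.reduceEqDiff, SimpleGraph.dist_eq_one_iff_adj, Set.mem_ofPred_eq,
          SimpleGraph.mem_commonNeighbors]
        exact and_comm
      rw [key, ncard_commonNeighbors hc huv.1]
      simp [h]
  · have huv := (dist_eq_three_iff hc hc0).1 h
    constructor
    · have key : {z | (voltageCover f hf).Adj v z ∧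
          (voltageCover f hf).dist u z = (voltageCover f hf).dist u v + 1} = ∅ := by
        rw [Set.eq_empty_iff_forall_notMem]
        rintro z ⟨-, hz⟩
        rcases dist_cases (hf := hf) hc hc0 u z with rfl | h' | h' | h'
        · simp [h] at hz
        all_goals omega
      rw [key]
      simp [h]
    · have key : {z | (voltageCover f hf).Adj v z ∧
          (voltageCover f hf).dist u z + 1 = (voltageCover f hf).dist u v} =
          {z | (voltageCover f hf).Adj v z} := by
        ext z
        simp only [h, Nat.reduceEqDiff, dist_eq_two_iff hc hc0, Set.mem_ofPred_eq]
        exact ⟨fun e => e.1, fun e => ⟨e, huv.2 ▸ e.1, fun e' =>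
          huv.1 (eq_of_adj_of_fst_eq e'.symm e.symm huv.2)⟩⟩
      rw [key, ncard_neighborSet]
      simp [h]

theorem isDRACKN [Finite W] [Finite H] [Nontrivial W] [Nontrivial H] :
    (voltageCover f hf).IsDRACKN (Nat.card W) (Nat.card H) c where
  distanceRegular := isDistanceRegular hc hc0
  diam_eq := by
    apply le_antisymm
    · obtain ⟨u, v, huv⟩ := (voltageCover f hf).exists_dist_eq_diam
      rw [← huv]
      rcases dist_cases (hf := hf) hc hc0 u v with rfl | h | h | h
      · simp
      all_goals omega
    · obtain ⟨x, -⟩ := exists_pair_ne W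
      obtain ⟨a, b, hab⟩ := exists_pair_ne H
      rw [← (dist_eq_three_iff (hf := hf) hc hc0 (u := (x, a)) (v := (x, b))).2
        ⟨by simpa using hab, rfl⟩]
      exact SimpleGraph.dist_le_diam
        (SimpleGraph.connected_iff_ediam_ne_top.1 (connected hc hc0))
  antipodal := by
    simp only [eq_or_dist_eq_three_iff hc hc0]
    exact ⟨fun _ => rfl, Eq.symm, Eq.trans⟩
  card_fibre u := by
    simp only [eq_or_dist_eq_three_iff hc hc0]
    have : {v : W × H | u.1 = v.1} = Prod.mk u.1 '' Set.univ := by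
      ext ⟨x, a⟩
      simp
    rw [this, Set.ncard_image_of_injective _ (Prod.mk_right_injective _), Set.ncard_univ]
  card_fibres := by
    refine Nat.card_congr (Equiv.ofBijective
      (Quotient.lift Prod.fst fun u v h => (eq_or_dist_eq_three_iff hc hc0).1 h) ⟨?_, ?_⟩)
    · rintro ⟨u⟩ ⟨v⟩ h
      exact Quotient.sound ((eq_or_dist_eq_three_iff hc hc0).2 h)
    · exact fun x => ⟨Quotient.mk _ (x, 0), rfl⟩
  matching u v h := by
    rw [eq_or_dist_eq_three_iff hc hc0] at h
    simp only [eq_or_dist_eq_three_iff hc hc0]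
    exact ⟨(v.1, u.2 + f u.1 v.1), ⟨rfl, h, rfl⟩, fun z hz => Prod.ext hz.1.symm (by
      rw [hz.2.2, hz.1])⟩
  common u v h := ncard_commonNeighbors hc ((dist_eq_two_iff hc hc0).1 h).1

end voltageCover

/-! ### Intersection numbers when all valencies are equal -/

namespace AssociationScheme

variable {Ω : Type*} [Fintype Ω] {d : ℕ} {X : AssociationScheme Ω d}

theorem col_self (X : AssociationScheme Ω d) (x : Ω) : X.col x x = 0 := (X.diag x x).2 rfl

theorem card_filter_mem (X : AssociationScheme Ω d) (S : Finset (Fin (d + 1) × Fin (d + 1)))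
    (x y : Ω) :
    (Finset.univ.filter fun z => (X.col x z, X.col z y) ∈ S).card =
      ∑ p ∈ S, X.inter p.1 p.2 (X.col x y) := by
  rw [Finset.card_eq_sum_card_fiberwise (f := fun z => (X.col x z, X.col z y)) (t := S)
    (fun z hz => by simpa using hz)]
  refine Finset.sum_congr rfl fun p hp => ?_
  rw [← X.regular p.1 p.2 _ x y rfl, Finset.filter_filter]
  congr 1
  ext z
  simp only [Finset.mem_filter, Finset.mem_univ, true_and]
  constructor
  · rintro ⟨-, rfl⟩
    exact ⟨rfl, rfl⟩
  · rintro ⟨h1, h2⟩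
    have h : (X.col x z, X.col z y) = p := Prod.ext h1 h2
    exact ⟨h ▸ hp, h⟩

theorem inter_zero (X : AssociationScheme Ω d) (i k : Fin (d + 1)) :
    X.inter i 0 k = if i = k then 1 else 0 := by
  obtain ⟨x, y, rfl⟩ := X.nonempty k
  rw [← X.regular i 0 _ x y rfl]
  split_ifs with h
  · rw [Finset.card_eq_one]
    refine ⟨y, ?_⟩
    ext z
    simp only [X.diag, Finset.mem_filter, Finset.mem_univ, true_and, Finset.mem_singleton]
    exact ⟨fun e => e.2, fun e => ⟨e ▸ h.symm, e⟩⟩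
  · rw [Finset.card_eq_zero, Finset.filter_eq_empty_iff]
    rintro z - ⟨h1, h2⟩
    rw [X.diag] at h2
    exact h (h2 ▸ h1.symm)

section Valency

variable {κ : ℕ} (hκ : ∀ i, i ≠ 0 → ∀ x, (Finset.univ.filter fun y => X.col x y = i).card = κ)

include hκ

theorem sum_inter {i : Fin (d + 1)} (hi : i ≠ 0) (k : Fin (d + 1)) : ∑ j, X.inter i j k = κ := by
  obtain ⟨x, y, rfl⟩ := X.nonempty k
  rw [← hκ i hi x, Finset.card_eq_sum_card_fiberwise (f := fun z => X.col z y)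
    (t := Finset.univ) (fun z hz => by simp)]
  refine Finset.sum_congr rfl fun j _ => ?_
  rw [← X.regular i j _ x y rfl, Finset.filter_filter]

theorem valency_pos (hd : 0 < d) : 0 < κ := by
  have h : (Fin.last d) ≠ 0 := by simpa [Fin.ext_iff] using hd.ne'
  obtain ⟨x, y, hxy⟩ := X.nonempty (Fin.last d)
  rw [← hκ _ h x, Finset.card_pos]
  exact ⟨y, by simpa using hxy⟩

theorem card_eq : Fintype.card Ω = d * κ + 1 := by
  obtain ⟨x, -, -⟩ := X.nonempty 0
  rw [← Finset.card_univ, Finset.card_eq_sum_card_fiberwise (f := fun z => X.col x z)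
    (t := Finset.univ) (fun z hz => by simp), Fin.sum_univ_succ]
  have h0 : (Finset.univ.filter fun y => X.col x y = 0).card = 1 := by
    rw [Finset.card_eq_one]
    exact ⟨x, by ext; simp [X.diag, eq_comm]⟩
  rw [h0, Finset.sum_congr rfl fun i _ => hκ _ (Fin.succ_ne_zero i) x]
  simp [add_comm]

/-- Fix `x` and count the pairs `(y, z)` with `(x, y)`, `(x, z)`, `(z, y)` in `R_k`, `R_i`, `R_j` in
two ways; the equal valencies cancel. -/
theorem inter_swap (hX : X.IsSymmetric) {i k : Fin (d + 1)} (hi : i ≠ 0) (hk : k ≠ 0)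
    (j : Fin (d + 1)) : X.inter i j k = X.inter k j i := by
  have hκ0 : 0 < κ := valency_pos hκ (by
    rcases Nat.eq_zero_or_pos d with rfl | h
    · exact absurd (Fin.fin_one_eq_zero i) hi
    · exact h)
  obtain ⟨x, -, -⟩ := X.nonempty 0
  have key := Finset.sum_card_bipartiteAbove_eq_sum_card_bipartiteBelow
    (s := Finset.univ.filter fun y => X.col x y = k)
    (t := Finset.univ.filter fun z => X.col x z = i) (fun y z => X.col z y = j)
  rw [Finset.sum_congr rfl (g := fun _ => X.inter i j k),
    Finset.sum_congr rfl (s₂ := Finset.univ.filter fun z => X.col x z = i)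
      (g := fun _ => X.inter k j i)] at key
  · simp only [Finset.sum_const, hκ i hi, hκ k hk, smul_eq_mul] at key
    exact Nat.eq_of_mul_eq_mul_left hκ0 key
  · intro z hz
    simp only [Finset.mem_filter, Finset.mem_univ, true_and] at hz
    rw [← X.regular k j i x z hz, Finset.bipartiteBelow, Finset.filter_filter]
    simp only [hX z]
  · intro y hy
    simp only [Finset.mem_filter, Finset.mem_univ, true_and] at hy
    rw [← X.regular i j k x y hy, Finset.bipartiteAbove, Finset.filter_filter]

/-- Compare with the row sum of `p_{ki}^k`: the terms agree at `i = k`, both equal `b` at other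
nonzero `i`, and `p_{k0}^k = 1` is the missing unit. In the cover, that unit is the path through
`none`. -/
theorem sum_inter_diag (hX : X.IsSymmetric) {b : ℕ}
    (hb : ∀ i j, i ≠ 0 → j ≠ 0 → i ≠ j → X.inter i i j = b) {k : Fin (d + 1)} (hk : k ≠ 0) :
    ∑ i : Fin d, X.inter i.succ i.succ k + 1 = κ := by
  rw [← sum_inter hκ hk k, Fin.sum_univ_succ, inter_zero, if_pos rfl, add_comm]
  congr 1
  refine Finset.sum_congr rfl fun i _ => ?_
  have hi := Fin.succ_ne_zero i
  by_cases h : i.succ = k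
  · rw [h]
  · rw [hb _ _ hi hk h, X.comm, inter_swap hκ hX hi hk, hb _ _ hk hi (Ne.symm h)]

/-- Compare with the row sum of `p_{mi}^k` for `m = σ k`, where `p_{m0}^k = 0`. The terms at `i = k`
and `i = σ k` are all `b`; every other term is the constant `a` attached to `k`. -/
theorem sum_inter_involution (hX : X.IsSymmetric) {b : ℕ}
    (hb : ∀ i j, i ≠ 0 → j ≠ 0 → i ≠ j → X.inter i i j = b)
    (ha : ∀ k, k ≠ 0 → ∃ a, ∀ i j, i ≠ 0 → j ≠ 0 → i ≠ j → i ≠ k → j ≠ k → X.inter i j k = a)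
    (σ : Fin d → Fin d) (hσ : ∀ i, σ (σ i) = i) (hσ' : ∀ i, σ i ≠ i) (k : Fin d) :
    ∑ i : Fin d, X.inter i.succ (σ i).succ k.succ = κ := by
  have hn : ∀ i : Fin d, i.succ ≠ 0 := Fin.succ_ne_zero
  have inj : ∀ {i j : Fin d}, i ≠ j → i.succ ≠ j.succ := fun h e => h (Fin.succ_injective _ e)
  have hb' : ∀ i j, i ≠ 0 → j ≠ 0 → i ≠ j → X.inter i j i = b := fun i j hi hj h => by
    rw [X.comm, inter_swap hκ hX hj hi, hb i j hi hj h]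
  obtain ⟨a, ha⟩ := ha k.succ (hn k)
  rw [← sum_inter hκ (hn (σ k)) k.succ, Fin.sum_univ_succ, inter_zero, if_neg (inj (hσ' k)),
    zero_add]
  refine Finset.sum_congr rfl fun i _ => ?_
  by_cases h1 : i = k
  · subst h1
    rw [hb' _ _ (hn _) (hn _) (inj (hσ' i).symm), X.comm, hb' _ _ (hn _) (hn _) (inj (hσ' i).symm)]
  by_cases h2 : i = σ k
  · subst h2
    rw [hσ, X.comm, hb' _ _ (hn _) (hn _) (inj (hσ' k).symm), hb _ _ (hn _) (hn _) (inj (hσ' k))]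
  · rw [ha _ _ (hn _) (hn _) (inj (hσ' i).symm) (inj h1)
      (inj fun e => h2 (by rw [← e, hσ])), ha _ _ (hn _) (hn _) (inj (Ne.symm h2))
      (inj (hσ' k)) (inj h1)]

end Valency

/-! ### Merging two relations of an amorphic scheme -/

theorem exists_merge {k l : Fin (d + 1)} (hk : k ≠ 0) (hl : l ≠ 0) (hkl : k ≠ l) :
    ∃ (e : ℕ) (π : Fin (d + 1) → Fin (e + 1)), Function.Surjective π ∧ (∀ i, π i = 0 ↔ i = 0) ∧
      ∀ i j, π i = π j ↔ i = j ∨ (i = k ∧ j = l) ∨ (i = l ∧ j = k) := by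
  obtain ⟨e, rfl⟩ : ∃ e, d = e + 1 := Nat.exists_eq_succ_of_ne_zero (by
    rintro rfl
    exact hk (Fin.fin_one_eq_zero k))
  -- The map `π` redirects `l` to `k` and then closes the gap at `l`; since `l ≠ 0`, the index `0`
  -- stays in place.
  have h : ∀ i : Fin (e + 1 + 1), (if i = l then k else i) ≠ l := fun i => by
    split_ifs with h
    exacts [hkl, h]
  have key : ∀ i j, (finSuccAboveEquiv l).symm ⟨_, h i⟩ = (finSuccAboveEquiv l).symm ⟨_, h j⟩ ↔
      i = j ∨ (i = k ∧ j = l) ∨ (i = l ∧ j = k) := fun i j => by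
    rw [EmbeddingLike.apply_eq_iff_eq, Subtype.mk.injEq]
    split_ifs <;> grind
  have h0 : (finSuccAboveEquiv l).symm ⟨_, h 0⟩ = 0 := by
    rw [Equiv.symm_apply_eq, finSuccAboveEquiv_apply]
    simp [Fin.succAbove_ne_zero_zero hl, hl.symm]
  refine ⟨e, fun i => (finSuccAboveEquiv l).symm ⟨_, h i⟩, fun j => ?_, fun i => ?_, key⟩
  · refine ⟨finSuccAboveEquiv l j, ?_⟩
    exact (Equiv.symm_apply_eq _).2 <| Subtype.ext (if_neg (finSuccAboveEquiv l j).2)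
  · rw [← h0, key]
    grind

theorem IsAmorphic.sum_inter_eq (hX : X.IsAmorphic) {e : ℕ} {π : Fin (d + 1) → Fin (e + 1)}
    (hπ : Function.Surjective π) (h0 : ∀ i, π i = 0 ↔ i = 0) {k l : Fin (d + 1)}
    (hkl : π k = π l) (i j : Fin (d + 1)) :
    ∑ p : Fin (d + 1) × Fin (d + 1) with π p.1 = π i ∧ π p.2 = π j, X.inter p.1 p.2 k =
      ∑ p : Fin (d + 1) × Fin (d + 1) with π p.1 = π i ∧ π p.2 = π j, X.inter p.1 p.2 l := by
  obtain ⟨Y, hY⟩ := hX.2 e π hπ h0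
  have key : ∀ m, ∑ p : Fin (d + 1) × Fin (d + 1) with π p.1 = π i ∧ π p.2 = π j, X.inter p.1 p.2 m =
      Y.inter (π i) (π j) (π m) := fun m => by
    obtain ⟨x, y, rfl⟩ := X.nonempty m
    rw [← X.card_filter_mem, ← Y.regular _ _ _ x y (hY x y)]
    simp [hY]
  rw [key, key, hkl]

/-- Once `k` and `l` are merged, `i` and `j` remain singleton classes, so the fused intersection
number is `p_{ij}` at either index. -/
theorem IsAmorphic.inter_eq_of_ne (hX : X.IsAmorphic) {i j k l : Fin (d + 1)} (hk : k ≠ 0)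
    (hl : l ≠ 0) (hik : i ≠ k) (hil : i ≠ l) (hjk : j ≠ k) (hjl : j ≠ l) :
    X.inter i j k = X.inter i j l := by
  by_cases hkl : k = l
  · rw [hkl]
  obtain ⟨e, π, hπ, h0, h⟩ := exists_merge hk hl hkl
  have key := hX.sum_inter_eq hπ h0 (show π k = π l by simp [h]) i j
  have : (Finset.univ.filter fun p : Fin (d + 1) × Fin (d + 1) => π p.1 = π i ∧ π p.2 = π j) =
      {(i, j)} := by
    ext ⟨a, b⟩
    simp [h, hik, hil, hjk, hjl]
  simpa [this] using key

theorem IsAmorphic.inter_add_inter (hX : X.IsAmorphic) {i j k : Fin (d + 1)} (hi : i ≠ 0)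
    (hk : k ≠ 0) (hik : i ≠ k) (hji : j ≠ i) (hjk : j ≠ k) :
    X.inter i j i + X.inter k j i = X.inter i j k + X.inter k j k := by
  obtain ⟨e, π, hπ, h0, h⟩ := exists_merge hi hk hik
  have key := hX.sum_inter_eq hπ h0 (show π i = π k by simp [h]) i j
  have : (Finset.univ.filter fun p : Fin (d + 1) × Fin (d + 1) => π p.1 = π i ∧ π p.2 = π j) =
      {(i, j), (k, j)} := by
    ext ⟨a, b⟩
    simp only [h, Finset.mem_filter, Finset.mem_univ, true_and, Finset.mem_insert,
      Finset.mem_singleton, Prod.mk.injEq]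
    grind
  rwa [this, Finset.sum_pair (by simpa using hik), Finset.sum_pair (by simpa using hik)] at key

theorem exists_ne_of_three_le (hd : 3 ≤ d) (i j : Fin (d + 1)) : ∃ l, l ≠ 0 ∧ l ≠ i ∧ l ≠ j := by
  by_contra! h
  have : (Finset.univ : Finset (Fin (d + 1))) ⊆ {0, i, j} := fun l _ => by
    simp only [Finset.mem_insert, Finset.mem_singleton]
    by_contra! hl
    exact hl.2.2 (h l hl.1 hl.2.1)
  have := (Finset.card_le_card this).trans Finset.card_le_three
  simp at this
  omega

/-- Independence of the upper index is `inter_eq_of_ne`. For the lower index, `inter_swap` cancels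
the mixed terms of `inter_add_inter` and leaves `p_{ii}^j = p_{kk}^j`. -/
theorem IsAmorphic.exists_inter_self_eq (hX : X.IsAmorphic) {κ : ℕ}
    (hκ : ∀ i, i ≠ 0 → ∀ x, (Finset.univ.filter fun y => X.col x y = i).card = κ) (hd : 3 ≤ d) :
    ∃ b, ∀ i j, i ≠ 0 → j ≠ 0 → i ≠ j → X.inter i i j = b := by
  have right : ∀ {i j l}, j ≠ 0 → l ≠ 0 → i ≠ j → i ≠ l → X.inter i i j = X.inter i i l :=
    fun hj hl hij hil => hX.inter_eq_of_ne hj hl hij hil hij hil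
  have left : ∀ {i j k}, i ≠ 0 → j ≠ 0 → k ≠ 0 → i ≠ j → k ≠ j →
      X.inter i i j = X.inter k k j := fun {i j k} hi hj hk hij hkj => by
    by_cases hik : i = k
    · rw [hik]
    have h := hX.inter_add_inter hi hk hik hij.symm hkj.symm
    rw [inter_swap hκ hX.1 hk hi, X.comm i j i, X.comm k j k, inter_swap hκ hX.1 hj hi,
      inter_swap hκ hX.1 hj hk] at h
    omega
  have h1 : (1 : Fin (d + 1)) ≠ 0 := by
    have : NeZero d := ⟨by omega⟩
    simp
  obtain ⟨m, hm0, hm1, -⟩ := exists_ne_of_three_le hd 1 1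
  refine ⟨X.inter 1 1 m, fun i j hi hj hij => ?_⟩
  by_cases hj1 : j = 1
  · obtain ⟨l, hl0, hli, hl1⟩ := exists_ne_of_three_le hd i 1
    rw [right hj hl0 hij hli.symm, left hi hl0 h1 hli.symm hl1.symm, right hl0 hm0 hl1.symm hm1.symm]
  · rw [left hi hj h1 hij (Ne.symm hj1), right hj hm0 (Ne.symm hj1) hm1.symm]

/-- By `inter_swap`, `p_{ij}^k = p_{ik}^j`, so a lower index can be exchanged as if it were an upper
one. -/
theorem IsAmorphic.exists_inter_eq (hX : X.IsAmorphic) {κ : ℕ}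
    (hκ : ∀ i, i ≠ 0 → ∀ x, (Finset.univ.filter fun y => X.col x y = i).card = κ)
    {k : Fin (d + 1)} (hk : k ≠ 0) :
    ∃ a, ∀ i j, i ≠ 0 → j ≠ 0 → i ≠ j → i ≠ k → j ≠ k → X.inter i j k = a := by
  have right : ∀ {i j l}, i ≠ 0 → j ≠ 0 → l ≠ 0 → i ≠ j → i ≠ k → j ≠ k → l ≠ i → l ≠ k →
      X.inter i j k = X.inter i l k := fun {i j l} hi hj hl hij hik hjk hli hlk => by
    rw [X.comm i j, X.comm i l, inter_swap hκ hX.1 hj hk, inter_swap hκ hX.1 hl hk,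
      X.comm k i, X.comm k i]
    exact hX.inter_eq_of_ne hj hl hij hli.symm hjk.symm hlk.symm
  by_cases h : ∃ i j, i ≠ 0 ∧ j ≠ 0 ∧ i ≠ j ∧ i ≠ k ∧ j ≠ k
  · obtain ⟨m, l, hm, hl, hml, hmk, hlk⟩ := h
    refine ⟨X.inter m l k, fun i j hi hj hij hik hjk => ?_⟩
    by_cases him : i = m
    · subst him
      exact right hi hj hl hij hik hjk hml.symm hlk
    · rw [right hi hj hm hij hik hjk (Ne.symm him) hmk, X.comm,
        right hm hi hl (Ne.symm him) hmk hik hml.symm hlk]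
  · push Not at h
    exact ⟨0, fun i j hi hj hij hik hjk => absurd (h i j hi hj hij hik) hjk⟩

end AssociationScheme

/-! ### Two classes: multiplicities and eigenvalues -/

theorem Matrix.trace_eq_rank_of_mul_self {n K : Type*} [Fintype n] [Field K]
    {E : Matrix n n K} (h : E * E = E) : E.trace = E.rank := by
  classical
  have hE : IsIdempotentElem (Matrix.toLin' E) := by
    rw [IsIdempotentElem, Module.End.mul_eq_comp, ← Matrix.toLin'_mul, h]
  rw [← Matrix.trace_toLin'_eq,
    ((LinearMap.isProj_range_iff_isIdempotentElem _).2 hE).trace]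
  rfl

namespace AssociationScheme

variable {Ω : Type*} [Fintype Ω] {X : AssociationScheme Ω 2}

theorem adjMatrix_apply {d : ℕ} (X : AssociationScheme Ω d) (i : Fin (d + 1)) (x y : Ω) :
    X.adjMatrix i x y = if X.col x y = i then 1 else 0 := rfl

theorem adjMatrix_zero [DecidableEq Ω] {d : ℕ} (X : AssociationScheme Ω d) :
    X.adjMatrix 0 = 1 := by
  ext x y
  simp [adjMatrix_apply, X.diag, Matrix.one_apply]

theorem adjMatrix_mul {d : ℕ} (X : AssociationScheme Ω d) (i j : Fin (d + 1)) :
    X.adjMatrix i * X.adjMatrix j = ∑ k, (X.inter i j k : ℂ) • X.adjMatrix k := by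
  ext x y
  simp only [Matrix.mul_apply, Matrix.sum_apply, Matrix.smul_apply, adjMatrix_apply, smul_eq_mul,
    mul_ite, mul_one, mul_zero, Finset.sum_ite_eq, Finset.mem_univ, if_true]
  rw [← X.regular i j _ x y rfl, Finset.card_filter]
  push_cast
  exact Finset.sum_congr rfl fun z _ => by split_ifs <;> simp_all

theorem sum_adjMatrix {d : ℕ} (X : AssociationScheme Ω d) :
    ∑ i, X.adjMatrix i = Matrix.of fun _ _ => 1 := by
  ext x y
  simp [Matrix.sum_apply, adjMatrix_apply]

/-- In a symmetric scheme with two classes, an idempotent of the Bose-Mesner algebra orthogonal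
to the all-one matrix is primitive as soon as it consists of eigenvectors of `R_1`. -/
theorem isPrimitiveIdempotent_of_mul_eq [DecidableEq Ω] {E : Matrix Ω Ω ℂ} {θ : ℂ}
    (hE : E ∈ X.boseMesner) (hE2 : E * E = E) (hE0 : E ≠ 0) (hA : X.adjMatrix 1 * E = θ • E)
    (hJ : (Matrix.of fun _ _ => 1 : Matrix Ω Ω ℂ) * E = 0) : X.IsPrimitiveIdempotent E := by
  refine ⟨hE, hE2, hE0, fun F hF hF2 hFE => ?_⟩
  have h2 : X.adjMatrix 2 * E = (-1 - θ) • E := by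
    have := X.sum_adjMatrix
    rw [Fin.sum_univ_three, adjMatrix_zero] at this
    rw [← this, add_mul, add_mul, hA, one_mul] at hJ
    rw [eq_neg_of_add_eq_zero_right hJ]
    module
  -- All of the Bose-Mesner algebra acts on `E` by scalars, so `F = F * E = t • E`, and idempotence
  -- leaves `t = 0` or `t = 1`.
  obtain ⟨t, ht⟩ : ∃ t : ℂ, F * E = t • E := by
    clear hF2 hFE
    rw [boseMesner] at hF
    induction hF using Submodule.span_induction with
    | mem M hM =>
      obtain ⟨i, rfl⟩ := hM
      fin_cases i
      · exact ⟨1, by simp [adjMatrix_zero]⟩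
      · exact ⟨θ, hA⟩
      · exact ⟨_, h2⟩
    | zero => exact ⟨0, by simp⟩
    | add M N _ _ hM hN =>
      obtain ⟨a, ha⟩ := hM
      obtain ⟨b, hb⟩ := hN
      exact ⟨a + b, by rw [add_mul, ha, hb, add_smul]⟩
    | smul c M _ hM =>
      obtain ⟨a, ha⟩ := hM
      exact ⟨c * a, by rw [smul_mul_assoc, ha, smul_smul]⟩
  rw [hFE] at ht
  have htt : (t * t - t) • E = 0 := by
    rw [ht, smul_mul_smul_comm, hE2] at hF2
    rw [sub_smul, hF2, sub_self]
  rcases smul_eq_zero.1 htt with h | h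
  · rcases mul_eq_zero.1 (show t * (t - 1) = 0 by linear_combination h) with h | h
    · exact .inl (by rw [ht, h, zero_smul])
    · exact .inr (by rw [ht, sub_eq_zero.1 h, one_smul])
  · exact absurd h hE0

theorem card_filter_eq_left {d κ : ℕ} {X : AssociationScheme Ω d} (hX : X.IsSymmetric)
    (hκ : ∀ i, i ≠ 0 → ∀ x, (Finset.univ.filter fun y => X.col x y = i).card = κ)
    {i : Fin (d + 1)} (hi : i ≠ 0) (y : Ω) :
    (Finset.univ.filter fun x => X.col x y = i).card = κ := by
  simp only [fun x => hX x y, hκ i hi y]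

/-- The rank of the eigenprojection of `R_1` for the eigenvalue `θ`, where `τ` is the other
nontrivial eigenvalue. -/
theorem exists_isPrimitiveIdempotent (hX : X.IsSymmetric) {κ : ℕ}
    (hκ : ∀ i, i ≠ 0 → ∀ x, (Finset.univ.filter fun y => X.col x y = i).card = κ) {θ τ : ℂ}
    (hne : θ ≠ τ) (hadd : θ + τ = (X.inter 1 1 1 : ℂ) - X.inter 1 1 2)
    (hmul : θ * τ = (X.inter 1 1 2 : ℂ) - κ) :
    ∃ E, X.IsPrimitiveIdempotent E ∧ E ≠ Matrix.of (fun _ _ => (1 / (Fintype.card Ω : ℂ))) ∧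
      (E.rank : ℂ) = (θ - τ)⁻¹ * (τ - κ - Fintype.card Ω * τ) := by
  classical
  have hcard := card_eq hκ
  have hn : (Fintype.card Ω : ℂ) = 2 * κ + 1 := by rw [hcard]; push_cast; ring
  have hn0 : (2 * κ + 1 : ℂ) ≠ 0 := by exact_mod_cast Nat.succ_ne_zero (2 * κ)
  set A := X.adjMatrix 1 with hA
  set J : Matrix Ω Ω ℂ := Matrix.of fun _ _ => 1 with hJ
  have hsum : 1 + A + X.adjMatrix 2 = J := by
    rw [hJ, ← X.sum_adjMatrix, Fin.sum_univ_three, adjMatrix_zero]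
  have hAJ : A * J = (κ : ℂ) • J := by
    ext x y
    simp [hA, hJ, Matrix.mul_apply, adjMatrix_apply, hκ 1 one_ne_zero x]
  have hJA : J * A = (κ : ℂ) • J := by
    ext x y
    simp [hA, hJ, Matrix.mul_apply, adjMatrix_apply, card_filter_eq_left hX hκ one_ne_zero y]
  have hJJ : J * J = (2 * κ + 1 : ℂ) • J := by
    ext x y
    simp [hJ, Matrix.mul_apply, hn]
  have h110 : X.inter 1 1 0 = κ := by
    obtain ⟨x, -, -⟩ := X.nonempty 0
    rw [← X.regular 1 1 0 x x (X.col_self x), ← hκ 1 one_ne_zero x]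
    congr 1
    ext z
    simp [hX z x]
  have hAA : A * A = (κ : ℂ) • (1 : Matrix Ω Ω ℂ) + (X.inter 1 1 1 : ℂ) • A +
      (X.inter 1 1 2 : ℂ) • (J - 1 - A) := by
    rw [hA, adjMatrix_mul, Fin.sum_univ_three, adjMatrix_zero, h110, ← hsum]
    congr 2
    abel
  have hrow : (X.inter 1 1 1 : ℂ) + X.inter 1 1 2 = κ - 1 := by
    have h := sum_inter hκ (one_ne_zero : (1 : Fin 3) ≠ 0) 1
    rw [Fin.sum_univ_three, inter_zero, if_pos rfl, X.comm 1 2,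
      inter_swap hκ hX two_ne_zero one_ne_zero] at h
    rw [← h]
    push_cast
    ring
  -- This `σ` makes `J * N = 0`. On the complement of the all-one vector, `A` satisfies the
  -- quadratic with roots `θ`, `τ`, so there `A - τ` is a multiple of the projection onto the
  -- `θ`-eigenspace.
  set σ : ℂ := (κ - τ) / (2 * κ + 1) with hσ
  have hσ' : σ * (2 * κ + 1) = κ - τ := div_mul_cancel₀ _ hn0
  set N : Matrix Ω Ω ℂ := A - τ • 1 - σ • J with hN
  have hJN : J * N = 0 := by
    rw [hN, mul_sub, mul_sub, hJA, mul_smul_comm, mul_smul_comm, mul_one, hJJ, smul_smul, hσ']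
    module
  have hAN : A * N = θ • N := by
    have key : (X.inter 1 1 2 : ℂ) - σ * κ = -θ * σ := by
      apply mul_right_cancel₀ hn0
      linear_combination (-κ + θ) * hσ' + (κ : ℂ) * hadd - hmul + (κ : ℂ) * hrow
    rw [hN, mul_sub, mul_sub, mul_smul_comm, mul_smul_comm, mul_one, hAJ, hAA]
    match_scalars
    · linear_combination hmul
    · linear_combination - hadd
    · linear_combination key
  have hNN : N * N = (θ - τ) • N := by
    nth_rw 1 [hN]
    rw [sub_mul, sub_mul, smul_mul_assoc, smul_mul_assoc, hJN, hAN, one_mul, smul_zero, sub_zero,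
      sub_smul]
  have hne' : θ - τ ≠ 0 := sub_ne_zero.2 hne
  have hEE : ((θ - τ)⁻¹ • N) * ((θ - τ)⁻¹ • N) = (θ - τ)⁻¹ • N := by
    rw [smul_mul_smul_comm, hNN, smul_smul, inv_mul_cancel_right₀ hne']
  have hN0 : N ≠ 0 := by
    -- The entries of `N` are `1 - σ` on `R_1` and `-σ` on `R_2`, which cannot both vanish.
    intro h
    obtain ⟨x, y, hxy⟩ := X.nonempty 1
    obtain ⟨x', y', hxy'⟩ := X.nonempty 2
    have h1 := congrFun (congrFun h x) y
    have h2 := congrFun (congrFun h x') y'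
    have n1 : x ≠ y := fun e => by simp [e, col_self] at hxy
    have n2 : x' ≠ y' := fun e => by simp [e, col_self] at hxy'
    simp [hN, hA, hJ, adjMatrix_apply, hxy, n1] at h1
    simp [hN, hA, hJ, adjMatrix_apply, hxy', n2] at h2
    simp [h2] at h1
  have hJE : J * ((θ - τ)⁻¹ • N) = 0 := by rw [mul_smul_comm, hJN, smul_zero]
  have hE0 : (θ - τ)⁻¹ • N ≠ 0 := smul_ne_zero (inv_ne_zero hne') hN0
  have hmem : (θ - τ)⁻¹ • N ∈ X.boseMesner := by
    have hm : ∀ i, X.adjMatrix i ∈ X.boseMesner := fun i => Submodule.subset_span ⟨i, rfl⟩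
    rw [hN, ← hsum, ← X.adjMatrix_zero]
    exact Submodule.smul_mem _ _ (Submodule.sub_mem _ (Submodule.sub_mem _ (hm 1)
      (Submodule.smul_mem _ _ (hm 0))) (Submodule.smul_mem _ _
      (Submodule.add_mem _ (Submodule.add_mem _ (hm 0) (hm 1)) (hm 2))))
  refine ⟨(θ - τ)⁻¹ • N, isPrimitiveIdempotent_of_mul_eq (θ := θ) hmem hEE hE0 ?_ hJE, ?_, ?_⟩
  · rw [← hA, mul_smul_comm, hAN, smul_comm]
  · intro h
    have hE : (Matrix.of fun _ _ => (1 / (Fintype.card Ω : ℂ))) =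
        (1 / (Fintype.card Ω : ℂ)) • J := by
      ext; simp [hJ]
    rw [h, hE, mul_smul_comm, hJJ, smul_smul, hn, one_div, inv_mul_cancel₀ hn0, one_smul] at hJE
    exact hE0 (by rw [h, hE, hJE, smul_zero])
  · rw [← Matrix.trace_eq_rank_of_mul_self hEE, Matrix.trace_smul, smul_eq_mul]
    congr 1
    have htA : A.trace = 0 := by simp [Matrix.trace, hA, adjMatrix_apply, col_self]
    have htJ : J.trace = 2 * κ + 1 := by simp [Matrix.trace, hJ, hn]
    rw [hN, Matrix.trace_sub, Matrix.trace_sub, Matrix.trace_smul, Matrix.trace_smul, htA, htJ,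
      Matrix.trace_one, smul_eq_mul, smul_eq_mul, hσ', hn]
    ring

theorem HasEqualMultiplicities.two_mul_inter (hm : X.HasEqualMultiplicities)
    (hX : X.IsSymmetric) {κ : ℕ}
    (hκ : ∀ i, i ≠ 0 → ∀ x, (Finset.univ.filter fun y => X.col x y = i).card = κ) :
    2 * X.inter 1 1 2 = κ := by
  have hκ0 : (κ : ℂ) ≠ 0 := by exact_mod_cast (valency_pos hκ two_pos).ne'
  have hrow : X.inter 1 1 1 + X.inter 1 1 2 + 1 = κ := by
    have h := sum_inter hκ (one_ne_zero : (1 : Fin 3) ≠ 0) 1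
    rw [Fin.sum_univ_three, inter_zero, if_pos rfl, X.comm 1 2,
      inter_swap hκ hX two_ne_zero one_ne_zero] at h
    omega
  have hrow' : (X.inter 1 1 1 : ℂ) + X.inter 1 1 2 + 1 = κ := by exact_mod_cast hrow
  -- A square root of the discriminant of the quadratic for `θ`, `τ`, with `κ - p_{11}^2` rewritten
  -- as `p_{11}^1 + 1`; this shows it is a positive integer.
  obtain ⟨δ, hδ⟩ := IsAlgClosed.exists_eq_mul_self
    (((X.inter 1 1 1 : ℂ) - X.inter 1 1 2) ^ 2 + 4 * (X.inter 1 1 1 + 1))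
  have hδ0 : δ ≠ 0 := by
    rintro rfl
    have h : (((X.inter 1 1 1 : ℤ) - X.inter 1 1 2) ^ 2 + 4 * (X.inter 1 1 1 + 1) : ℤ) = 0 := by
      rw [mul_zero] at hδ
      exact_mod_cast hδ
    have := sq_nonneg ((X.inter 1 1 1 : ℤ) - X.inter 1 1 2)
    omega
  set θ : ℂ := ((X.inter 1 1 1 : ℂ) - X.inter 1 1 2 + δ) / 2 with hθ
  set τ : ℂ := ((X.inter 1 1 1 : ℂ) - X.inter 1 1 2 - δ) / 2 with hτ
  have hsub : θ - τ = δ := by rw [hθ, hτ]; ring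
  have hadd : θ + τ = (X.inter 1 1 1 : ℂ) - X.inter 1 1 2 := by rw [hθ, hτ]; ring
  have hmul : θ * τ = (X.inter 1 1 2 : ℂ) - κ := by
    rw [hθ, hτ]; linear_combination hδ / 4 - hrow'
  have hne : θ ≠ τ := fun e => hδ0 (by rw [← hsub, e, sub_self])
  obtain ⟨m, hm⟩ := hm
  obtain ⟨E, hE, hE', hr⟩ := exists_isPrimitiveIdempotent hX hκ hne hadd hmul
  obtain ⟨F, hF, hF', hr'⟩ := exists_isPrimitiveIdempotent hX hκ hne.symm
    ((add_comm _ _).trans hadd) ((mul_comm _ _).trans hmul)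
  rw [hm E hE hE', hsub, eq_inv_mul_iff_mul_eq₀ hδ0] at hr
  rw [hm F hF hF', ← neg_sub, hsub, eq_inv_mul_iff_mul_eq₀ (neg_ne_zero.2 hδ0)] at hr'
  have hn : (Fintype.card Ω : ℂ) = 2 * κ + 1 := by rw [card_eq hκ]; push_cast; ring
  rw [hn] at hr hr'
  -- The two rank formulas have opposite denominators, so adding them eliminates the common rank
  -- `m`.
  have h1 : (θ + τ + 1) = 0 := by
    apply mul_left_cancel₀ hκ0
    linear_combination (hr + hr') / 2
  have h2 : (2 * X.inter 1 1 2 : ℂ) = κ := by linear_combination hadd - h1 + hrow'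
  exact_mod_cast h2

end AssociationScheme

/-! ### Voltages from a scheme and their path counts -/

namespace AssociationScheme

variable {Ω : Type*} [Fintype Ω] {r : ℕ}

theorem exists_inter_self_eq {X : AssociationScheme Ω r} {s κ : ℕ} (hs : 1 ≤ s) (hr : r = 2 ^ s)
    (hX : X.IsAmorphic)
    (hκ : ∀ i, i ≠ 0 → ∀ x, (Finset.univ.filter fun y => X.col x y = i).card = κ)
    (h2 : r = 2 → X.HasEqualMultiplicities) :
    ∃ b, ∀ i j, i ≠ 0 → j ≠ 0 → i ≠ j → X.inter i i j = b := by
  by_cases hd : 3 ≤ r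
  · exact hX.exists_inter_self_eq hκ hd
  have : 2 ^ 1 ≤ 2 ^ s := Nat.pow_le_pow_right two_pos hs
  obtain rfl : r = 2 := by omega
  have h := (h2 rfl).two_mul_inter hX.1 hκ
  have hrow := sum_inter hκ (by decide : (2 : Fin 3) ≠ 0) 1
  rw [Fin.sum_univ_three, inter_zero, if_neg (by decide), X.comm 2 1,
    inter_swap hκ hX.1 one_ne_zero one_ne_zero, X.comm 1 2,
    inter_swap hκ hX.1 (by decide) one_ne_zero] at hrow
  refine ⟨X.inter 1 1 2, fun i j hi hj hij => ?_⟩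
  -- The row sum reads `p_{11}^2 + p_{22}^1 = κ`, and `p_{11}^2` is half of `κ`.
  have h21 : X.inter 2 2 1 = X.inter 1 1 2 := by omega
  fin_cases i <;> fin_cases j <;>
    first | exact absurd rfl hi | exact absurd rfl hj | exact absurd rfl hij | rfl | exact h21

/-- The voltages of the cover defined by a labelling `e` of the relations by group elements; the
new vertex `none` is joined to the others with voltage zero. -/
def voltage {H : Type*} [Zero H] (X : AssociationScheme Ω r) (e : Fin r → H) :
    Option Ω → Option Ω → H
  | some x, some y => Fin.cases 0 e (X.col x y)
  | _, _ => 0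

theorem voltage_comm {H : Type*} [Zero H] {X : AssociationScheme Ω r} (hX : X.IsSymmetric)
    (e : Fin r → H) (x y : Option Ω) : X.voltage e x y = X.voltage e y x := by
  cases x <;> cases y <;> simp only [voltage]
  rw [hX]

theorem ncard_voltage_none {H : Type*} [AddCommGroup H] {X : AssociationScheme Ω r} {κ : ℕ}
    (hX : X.IsSymmetric)
    (hκ : ∀ i, i ≠ 0 → ∀ x, (Finset.univ.filter fun y => X.col x y = i).card = κ)
    (e : Fin r ≃ H) (y : Ω) (h : H) :
    {z | z ≠ none ∧ z ≠ some y ∧ X.voltage e none z + X.voltage e z (some y) = h}.ncard = κ := by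
  rw [← card_filter_eq_left hX hκ (Fin.succ_ne_zero (e.symm h)) y, ← Set.ncard_coe_finset,
    ← Set.ncard_image_of_injective _ (Option.some_injective Ω)]
  congr 1
  ext z
  cases z with
  | none => simp
  | some z =>
    simp only [voltage, ne_eq, reduceCtorEq, not_false_eq_true, Option.some_inj, zero_add,
      true_and, Set.mem_ofPred_eq, Set.mem_image, Finset.mem_coe, Finset.mem_filter,
      Finset.mem_univ, exists_eq_right, ← X.diag z y]
    cases X.col z y using Fin.cases with
    | zero => simp [(Fin.succ_ne_zero _).symm]
    | succ i => simp [Fin.succ_ne_zero, Equiv.eq_symm_apply]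

theorem ncard_voltage_some {H : Type*} [AddCommGroup H] {X : AssociationScheme Ω r}
    (e : Fin r ≃ H) {x y : Ω} (h : H) :
    {z : Ω | z ≠ x ∧ z ≠ y ∧
      X.voltage e (some x) (some z) + X.voltage e (some z) (some y) = h}.ncard =
      ∑ i : Fin r, X.inter i.succ (e.symm (h - e i)).succ (X.col x y) := by
  have inj : Function.Injective fun i : Fin r => (i.succ, (e.symm (h - e i)).succ) :=
    fun i j hij => Fin.succ_injective _ (congrArg Prod.fst hij)
  rw [← Finset.sum_image (s := Finset.univ) (g := fun i : Fin r => (i.succ,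
    (e.symm (h - e i)).succ)) (f := fun p => X.inter p.1 p.2 (X.col x y)) inj.injOn,
    ← card_filter_mem, ← Set.ncard_coe_finset]
  congr 1
  ext z
  simp only [voltage, Set.mem_ofPred_eq, Finset.mem_coe, Finset.mem_filter, Finset.mem_univ,
    true_and, Finset.mem_image, Prod.mk.injEq, ne_eq, eq_comm (a := z) (b := x), ← X.diag x z,
    ← X.diag z y]
  cases X.col x z using Fin.cases with
  | zero => simp [Fin.succ_ne_zero]
  | succ i =>
    cases X.col z y using Fin.cases with
    | zero => simp [Fin.succ_ne_zero]
    | succ j =>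
      simp only [Fin.succ_ne_zero, not_false_eq_true, Fin.cases_succ, true_and, Fin.succ_inj,
        exists_eq_left, Equiv.symm_apply_eq]
      rw [sub_eq_iff_eq_add', eq_comm]

theorem ncard_voltage {H : Type*} [AddCommGroup H] (hH : ∀ h : H, h + h = 0)
    {X : AssociationScheme Ω r} {κ b : ℕ} (hX : X.IsSymmetric)
    (hκ : ∀ i, i ≠ 0 → ∀ x, (Finset.univ.filter fun y => X.col x y = i).card = κ)
    (hb : ∀ i j, i ≠ 0 → j ≠ 0 → i ≠ j → X.inter i i j = b)
    (ha : ∀ k, k ≠ 0 → ∃ a, ∀ i j, i ≠ 0 → j ≠ 0 → i ≠ j → i ≠ k → j ≠ k → X.inter i j k = a)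
    (e : Fin r ≃ H) (x y : Option Ω) (hxy : x ≠ y) (h : H) :
    {z | z ≠ x ∧ z ≠ y ∧ X.voltage e x z + X.voltage e z y = h}.ncard = κ := by
  cases x with
  | none =>
    cases y with
    | none => exact absurd rfl hxy
    | some y => exact ncard_voltage_none hX hκ e y h
  | some x =>
    cases y with
    | none =>
      rw [← ncard_voltage_none hX hκ e x h]
      congr 1
      ext z
      rw [Set.mem_ofPred_eq, Set.mem_ofPred_eq, and_left_comm, add_comm,
        voltage_comm hX e z none, voltage_comm hX e z (some x)]
    | some y =>
      have hk : X.col x y ≠ 0 := fun h => hxy (by rw [(X.diag x y).1 h])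
      -- This counts only middle points in `Ω`. The path through `none` has voltage zero, so it adds
      -- one exactly when `h = 0`.
      have hS := ncard_voltage_some (X := X) e (x := x) (y := y) h
      by_cases h0 : h = 0
      · subst h0
        have hσ : ∀ i, e.symm (0 - e i) = i := fun i => by
          rw [Equiv.symm_apply_eq, zero_sub, neg_eq_of_add_eq_zero_left (hH _)]
        simp only [hσ] at hS
        rw [← sum_inter_diag hκ hX hb hk, ← hS,
          ← Set.ncard_image_of_injective _ (Option.some_injective Ω),
          ← Set.ncard_insert_of_notMem (a := none) (by simp)]
        congr 1
        ext z
        cases z <;> simp [voltage]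
      · obtain ⟨k, hk'⟩ := Fin.exists_succ_eq.2 hk
        -- A fixed point `i` would give `h = e i + e i = 0`.
        rw [← hk', sum_inter_involution hκ hX hb ha (fun i => e.symm (h - e i))
          (fun i => by simp) (fun i hi => h0 (by
            rw [Equiv.symm_apply_eq, sub_eq_iff_eq_add, hH] at hi
            exact hi))] at hS
        rw [← hS, ← Set.ncard_image_of_injective _ (Option.some_injective Ω)]
        congr 1
        ext z
        cases z <;> simp [voltage, Ne.symm h0]

end AssociationScheme

/-! ### The cover over the group `Fin s → ZMod 2` -/

theorem mainTheorem11 {Ω : Type*} [Fintype Ω] (n r s : ℕ) (hs : 1 ≤ s) (hr : r = 2 ^ s)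
    (hn : Fintype.card Ω = n) (X : AssociationScheme Ω r)
    (hX : X.IsAmorphic) (hX' : X.IsPseudocyclic)
    (h2 : r = 2 → X.HasEqualMultiplicities) :
    ∃ c : ℕ, (c : ℚ) = ((n : ℚ) - 1) / (r : ℚ) ∧
      ∃ (V : Type) (_ : Finite V) (G : SimpleGraph V), G.IsDRACKN (n + 1) r c := by
  obtain ⟨κ, hκ⟩ := hX'
  have hr0 : 0 < r := by rw [hr]; positivity
  have hκ0 : 0 < κ := AssociationScheme.valency_pos hκ hr0
  have hcard := AssociationScheme.card_eq hκ
  obtain ⟨b, hb⟩ := AssociationScheme.exists_inter_self_eq hs hr hX hκ h2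
  have hH : ∀ h : Fin s → ZMod 2, h + h = 0 := fun h => funext fun i => CharTwo.add_self_eq_zero _
  have hHcard : Fintype.card (Fin s → ZMod 2) = r := by simp [hr, ZMod.card]
  have e : Fin r ≃ (Fin s → ZMod 2) := (Fintype.equivFinOfCardEq hHcard).symm
  -- The vertex type must lie in `Type`, whatever the universe of `Ω`, so the points are relabelled
  -- by `Fin n`.
  have E : Option (Fin n) ≃ Option Ω := ((Fintype.equivFinOfCardEq hn).symm).optionCongr
  refine ⟨κ, ?_, _, inferInstance, voltageCover (fun x y => X.voltage e (E x) (E y))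
    fun x y => ?_, ?_⟩
  · rw [← hn, hcard, eq_div_iff (by positivity)]
    push_cast
    ring
  · exact (AssociationScheme.voltage_comm hX.1 _ _ _).trans (eq_neg_of_add_eq_zero_left (hH _))
  · have : Nontrivial (Option (Fin n)) := by
      rw [← Fintype.one_lt_card_iff_nontrivial, Fintype.card_option, Fintype.card_fin, ← hn, hcard]
      exact Nat.lt_add_of_pos_left (Nat.succ_pos _)
    have : Nontrivial (Fin s → ZMod 2) := by
      rw [← Fintype.one_lt_card_iff_nontrivial, hHcard, hr]
      exact Nat.one_lt_two_pow (by omega)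
    have key := voltageCover.isDRACKN (f := fun x y => X.voltage e (E x) (E y))
      (hf := fun x y => by
        exact (AssociationScheme.voltage_comm hX.1 _ _ _).trans (eq_neg_of_add_eq_zero_left (hH _)))
      (c := κ) (fun x y hxy h => ?_) hκ0
    · simpa [Nat.card_eq_fintype_card, hHcard] using key
    · rw [← AssociationScheme.ncard_voltage hH hX.1 hκ hb (fun k hk => hX.exists_inter_eq hκ hk) e
        (E x) (E y) (E.injective.ne hxy) h, ← Set.ncard_image_of_injective _ E.injective]
      congr 1
      ext z
      obtain ⟨w, rfl⟩ := E.surjective z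
      simp [E.injective.eq_iff]
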